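/- Let $X$ and $Y$ be regular quasi-projective schemes over $\mathbb{C}$ (that is, $\mathbb C$-schemes that admit an immersion over $\mathbb{C}$ into some projective space $\mathbb{P}^n_{\mathbb{C}}$, and all of whose local rings are regular), let $f:X\to Y$ be a morphism over $\mathbb{C}$, let $x\in X$ be a point, not necessarily closed, put $y=f(x)$, and let $X_y=X\times_Y\operatorname{Spec}\kappa(y)$ be the scheme-theoretic fibre of $f$ over $y$. For a scheme $Z$ and a point $z\in Z$ write $\dim_z Z$ for the Krull dimension of the local ring $\mathcal{O}_{Z,z}$. If $$\dim_x X=\dim_y Y+\dim_x X_y,$$ then $f$ is flat at $x$, that is, $\mathcal{O}_{X,x}$ is a flat $\mathcal{O}_{Y,y}$-module. -/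

import Mathlib

open CategoryTheory AlgebraicGeometry

noncomputable section

attribute [local instance] MvPolynomial.gradedAlgebra

/-- The base scheme `Spec ℂ`. -/
abbrev SpecC : Scheme.{0} := Spec (CommRingCat.of ℂ)

/-- Complex projective `n`-space, `Proj ℂ[T₀, …, Tₙ]` for the standard grading. -/
abbrev ProjSpaceC (n : ℕ) : Scheme.{0} :=
  Proj (MvPolynomial.homogeneousSubmodule (Fin (n + 1)) ℂ)

/-- The structure morphism of projective space over `Spec ℂ`: the canonical morphism from `Proj A`
to `Spec A₀`, followed by the morphism given by the `ℂ`-algebra structure of `A₀`. -/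
def ProjSpaceC.toSpecC (n : ℕ) : ProjSpaceC n ⟶ SpecC :=
  Proj.toSpecZero (MvPolynomial.homogeneousSubmodule (Fin (n + 1)) ℂ) ≫
    Spec.map (CommRingCat.ofHom
      (algebraMap ℂ (MvPolynomial.homogeneousSubmodule (Fin (n + 1)) ℂ 0)))

/-- A scheme over `ℂ` is quasi-projective if, as a scheme over `ℂ`, it admits an immersion
(an isomorphism onto a locally closed subscheme) into some projective space. -/
def IsQuasiProjectiveC (X : Scheme.{0}) [X.Over SpecC] : Prop :=
  ∃ (n : ℕ) (i : X ⟶ ProjSpaceC n), IsImmersion i ∧ i ≫ ProjSpaceC.toSpecC n = X ↘ SpecC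

/-- A scheme is regular if all its local rings are (Noetherian) regular local rings. -/
def IsRegularScheme (X : Scheme.{0}) : Prop :=
  ∀ x : X, IsRegularLocalRing (X.presheaf.stalk x)

/-- The dimension `dim_x X` of a scheme at a point: the Krull dimension of the local ring there. -/
def dimAt (X : Scheme.{0}) (x : X) : WithBot ℕ∞ :=
  ringKrullDim (X.presheaf.stalk x)

/-- A morphism `f : X ⟶ Y` is flat at `x` if `𝒪_{X,x}` is a flat module over `𝒪_{Y,f(x)}`. -/
def IsFlatAt {X Y : Scheme.{0}} (f : X ⟶ Y) (x : X) : Prop :=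
  (f.stalkMap x).hom.Flat

end

/-!
This is miracle flatness for the local homomorphism `R = 𝒪_{Y,f(x)} → S = 𝒪_{X,x}`: since `R` is
regular and `S` is Cohen–Macaulay, the equality `dim S = dim R + dim S / 𝔪_R S` forces flatness.

The proof is by induction on `dim R` (`Module.Flat.of_isRegularLocalRing_of_ringKrullDim_le`). If
`dim R = 0`, then `R` is a field. Otherwise choose `x ∈ 𝔪_R ∖ 𝔪_R²`, so that `R / xR` is regular of
dimension one less. As `S / xS` has dimension at most that of `R / xR` plus that of the closed
fibre, `x` cuts down the dimension of `S`; since `S` is Cohen–Macaulay, `x` is regular on `S`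
(`isSMulRegular_of_ringKrullDim_quotient_lt`) and `S / xS` is again Cohen–Macaulay
(`exists_isWeaklyRegular_quotSMulTop`, which rests on Rees' theorem). By induction `S / xS` is flat
over `R / xR`, and the local criterion `Module.Flat.of_quotient_span_singleton` gives flatness of
`S` over `R`. The latter is proved by Noetherian induction on the ideals `I` of `R`, showing that
`S ⊗ I → S` is injective with the help of the equational criterion and Nakayama's lemma.

Here a local ring is called Cohen–Macaulay if it has a regular sequence in its maximal ideal whose
length is the dimension of the ring. Regular local rings have this property
(`IsRegularLocalRing.exists_isWeaklyRegular`), because they are domains. For schemes, it remains to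
note that `S / 𝔪_R S` is a quotient of the local ring of the fibre
(`ringKrullDim_quotient_map_le_dimAt_fiber`), so its dimension is at most the one in the hypothesis.
-/

/-! ### Flatness modulo a regular element -/

section FlatnessModuloElement

open TensorProduct

variable {R S : Type*} [CommRing R] [CommRing S] [Algebra R S]

/-- A linear relation in `S` with coefficients in `R` whose reduction modulo `x` is trivial is itself
trivial up to multiples of `x`. The reductions are given as surjections onto rings `A` and `B`. -/
lemma exists_trivialization_of_isTrivialRelation {A B : Type*} [CommRing A] [CommRing B]
    [Algebra A B] (p : R →+* A) (q : S →+* B) (hp : Function.Surjective p)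
    (hq : Function.Surjective q) (hpq : q.comp (algebraMap R S) = (algebraMap A B).comp p)
    (x : R) (hxp : ∀ r, p r = 0 → x ∣ r) (hxq : ∀ t, q t = 0 → algebraMap R S x ∣ t)
    {n : ℕ} (a : Fin n → R) (s : Fin n → S)
    (h : Module.IsTrivialRelation (fun i ↦ p (a i)) (fun i ↦ q (s i))) :
    ∃ (k : ℕ) (c : Fin n → Fin k → R) (z : Fin k → S) (w : Fin n → S) (b : Fin k → R),
      (∀ i, s i = ∑ j, c i j • z j + x • w i) ∧ ∀ j, ∑ i, a i * c i j = x * b j := by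
  have hsmul (r : R) (t : S) : q (r • t) = p r • q t := by
    rw [Algebra.smul_def, map_mul, Algebra.smul_def]
    exact congr($hpq r * q t)
  obtain ⟨k, c, z, hs, hc⟩ := h
  choose c' hc' using fun i j ↦ hp (c i j)
  choose z' hz' using fun j ↦ hq (z j)
  have hw (i) : ∃ w, s i - ∑ j, c' i j • z' j = x • w := by
    simp_rw [Algebra.smul_def x]
    refine hxq _ ?_
    simp_rw [map_sub, map_sum, sub_eq_zero, hsmul, hc', hz']
    exact hs i
  have hb (j) : ∃ b, ∑ i, a i * c' i j = x * b := by
    refine hxp _ ?_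
    simpa [hc'] using hc j
  choose w hw using hw
  choose b hb using hb
  exact ⟨k, c', z', w, b, fun i ↦ by rw [← hw]; ring, hb⟩

/-- If `S / xS` is flat over `R / xR`, then every linear relation in `S` with coefficients in `R`
is trivial up to multiples of `x`. -/
lemma exists_trivialization_modulo (x : R) [Module.Flat (R ⧸ Ideal.span {x})
      (S ⧸ (Ideal.span {x}).map (algebraMap R S))]
    {n : ℕ} (a : Fin n → R) (s : Fin n → S) (h : ∑ i, a i • s i = 0) :
    ∃ (k : ℕ) (c : Fin n → Fin k → R) (z : Fin k → S) (w : Fin n → S) (b : Fin k → R),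
      (∀ i, s i = ∑ j, c i j • z j + x • w i) ∧ ∀ j, ∑ i, a i * c i j = x * b j := by
  refine exists_trivialization_of_isTrivialRelation (Ideal.Quotient.mk (Ideal.span {x}))
    (Ideal.Quotient.mk ((Ideal.span {x}).map (algebraMap R S))) Ideal.Quotient.mk_surjective
    Ideal.Quotient.mk_surjective rfl x
    (fun r hr ↦ by rwa [Ideal.Quotient.eq_zero_iff_mem, Ideal.mem_span_singleton] at hr)
    (fun t ht ↦ by
      rwa [Ideal.Quotient.eq_zero_iff_mem, Ideal.map_span, Set.image_singleton,
        Ideal.mem_span_singleton] at ht) a s ?_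
  apply Module.Flat.isTrivialRelation_of_sum_smul_eq_zero
  have := congr(Ideal.Quotient.mk ((Ideal.span {x}).map (algebraMap R S)) $h)
  rw [map_sum, map_zero] at this
  rw [← this]
  refine Finset.sum_congr rfl fun i _ ↦ ?_
  rw [Algebra.smul_def, Algebra.smul_def, map_mul]
  rfl

/-- For an ideal `I` containing an element `x` which is regular on `S`, flatness of `S / xS` over
`R / xR` gives injectivity of `S ⊗ I → S ⊗ R`: a trivialization modulo `x` rewrites an element of
the kernel as a single tensor `m ⊗ x`, and then `x m = 0` forces `m = 0`. -/
lemma lTensor_injective_of_mem (x : R) [Module.Flat (R ⧸ Ideal.span {x})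
      (S ⧸ (Ideal.span {x}).map (algebraMap R S))]
    (hreg : IsSMulRegular S x) (I : Ideal R) (hx : x ∈ I) :
    Function.Injective (LinearMap.lTensor S I.subtype) := by
  rw [injective_iff_map_eq_zero]
  intro t ht
  suffices h : ∃ m : S, t = m ⊗ₜ[R] (⟨x, hx⟩ : I) by
    obtain ⟨m, rfl⟩ := h
    have hm : x • m = 0 := by simpa using congr(TensorProduct.rid R S $ht)
    rw [hreg.right_eq_zero_of_smul hm, zero_tmul]
  obtain ⟨n, s, a, rfl⟩ := exists_sum_tmul_eq t
  have h : ∑ i, (a i : R) • s i = 0 := by simpa using congr(TensorProduct.rid R S $ht)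
  obtain ⟨k, c, z, w, b, hs, hb⟩ := exists_trivialization_modulo x _ s h
  refine ⟨∑ j, b j • z j + ∑ i, (a i : R) • w i, ?_⟩
  have h1 (j) : ∑ i, c i j • a i = b j • (⟨x, hx⟩ : I) := by
    ext; simpa [mul_comm] using hb j
  have h2 (i) : x • a i = (a i : R) • (⟨x, hx⟩ : I) := by
    ext; simp [mul_comm]
  calc ∑ i, s i ⊗ₜ[R] a i
      = ∑ j, z j ⊗ₜ[R] (∑ i, c i j • a i) + ∑ i, w i ⊗ₜ[R] (x • a i) := by
        simp_rw [hs, add_tmul, sum_tmul, tmul_sum, Finset.sum_add_distrib, ← smul_tmul]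
        rw [Finset.sum_comm]
    _ = _ := by simp_rw [h1, h2, add_tmul, sum_tmul, ← smul_tmul]

/-- If `x` is regular on `R / I` and on `S`, and `S / xS` is flat over `R / xR`, then the kernel of
`S ⊗ I → S ⊗ R` is divisible by `x`, so that it vanishes by Nakayama's lemma. -/
lemma lTensor_injective_of_regular_quotient [IsNoetherianRing R] [IsNoetherianRing S]
    (x : R) [Module.Flat (R ⧸ Ideal.span {x}) (S ⧸ (Ideal.span {x}).map (algebraMap R S))]
    (hreg : IsSMulRegular S x) (hjac : algebraMap R S x ∈ Ring.jacobson S)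
    (I : Ideal R) (hx : ∀ r, x * r ∈ I → r ∈ I) :
    Function.Injective (LinearMap.lTensor S I.subtype) := by
  let f : S ⊗[R] I →ₗ[S] S ⊗[R] R := AlgebraTensorModule.lTensor S S I.subtype
  suffices h : LinearMap.ker f = ⊥ from
    show Function.Injective f from LinearMap.ker_eq_bot.mp h
  refine Submodule.eq_bot_of_le_smul_of_le_jacobson_bot (Ideal.span {algebraMap R S x}) _
    (IsNoetherian.noetherian _) ?_ ?_
  · intro t ht
    obtain ⟨u, rfl⟩ : ∃ u, t = x • u := by
      obtain ⟨n, s, a, rfl⟩ := exists_sum_tmul_eq t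
      have h : ∑ i, (a i : R) • s i = 0 := by
        simpa [f] using congr(TensorProduct.rid R S $ht)
      obtain ⟨k, c, z, w, b, hs, hb⟩ := exists_trivialization_modulo x _ s h
      have hbI (j) : b j ∈ I :=
        hx _ (hb j ▸ I.sum_mem fun i _ ↦ I.mul_mem_right _ (a i).2)
      refine ⟨∑ j, z j ⊗ₜ[R] ⟨b j, hbI j⟩ + ∑ i, w i ⊗ₜ[R] a i, ?_⟩
      have h1 (j) : ∑ i, c i j • a i = x • (⟨b j, hbI j⟩ : I) := by
        ext; simpa [mul_comm] using hb j
      calc ∑ i, s i ⊗ₜ[R] a i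
          = ∑ j, z j ⊗ₜ[R] (∑ i, c i j • a i) + ∑ i, w i ⊗ₜ[R] (x • a i) := by
            simp_rw [hs, add_tmul, sum_tmul, tmul_sum, Finset.sum_add_distrib, ← smul_tmul]
            rw [Finset.sum_comm]
        _ = _ := by simp_rw [h1, smul_add, Finset.smul_sum, tmul_smul]
    rw [← algebraMap_smul S x u] at ht ⊢
    refine Submodule.smul_mem_smul (Ideal.mem_span_singleton_self _) ?_
    rw [LinearMap.mem_ker, map_smul, algebraMap_smul] at ht
    have : TensorProduct.rid R S (f u) = 0 :=
      hreg.right_eq_zero_of_smul (by rw [← map_smul, ht, map_zero])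
    simpa using this
  · rwa [Ideal.span_singleton_le_iff_mem, Ideal.jacobson_bot]

/-- The exact sequence `J → I × R → I + (x) → 0` with `J = (I : x)` reduces injectivity of
`S ⊗ I → S ⊗ R` to the same statement for `J` and for an ideal `K` containing `I` and `x`. -/
lemma lTensor_injective_of_colon (x : R) (I J K : Ideal R) (hJ : ∀ r, r ∈ J ↔ x * r ∈ I)
    (hK : K = I ⊔ Ideal.span {x})
    (hJinj : Function.Injective (LinearMap.lTensor S J.subtype))
    (hKinj : Function.Injective (LinearMap.lTensor S K.subtype)) :
    Function.Injective (LinearMap.lTensor S I.subtype) := by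
  have hIK : I ≤ K := hK ▸ le_sup_left
  have hxK : x ∈ K := hK ▸ Ideal.mem_sup_right (Ideal.mem_span_singleton_self x)
  let m : J →ₗ[R] I := (LinearMap.lsmul R R x).restrict fun r hr ↦ (hJ r).mp hr
  have hm (j : J) : (m j : R) = x * j := rfl
  let f : J →ₗ[R] I × R := m.prod (-J.subtype)
  let g : I × R →ₗ[R] K :=
    (Submodule.inclusion hIK).coprod (LinearMap.toSpanSingleton R K ⟨x, hxK⟩)
  have hg : Function.Surjective g := by
    rintro ⟨y, hy⟩
    rw [hK] at hy
    obtain ⟨a, ha, _, hb, rfl⟩ := Submodule.mem_sup.mp hy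
    obtain ⟨b, rfl⟩ := Ideal.mem_span_singleton'.mp hb
    exact ⟨(⟨a, ha⟩, b), by ext; simp [g]⟩
  have hfg : Function.Exact f g := by
    rintro ⟨⟨a, ha⟩, r⟩
    constructor
    · intro h
      have h : a + r * x = 0 := by simpa [g] using congr(($h : R))
      have h' : x * -r = a := by linear_combination -h
      exact ⟨⟨-r, (hJ _).mpr (h' ▸ ha)⟩, by ext <;> simp [f, hm, ← h']⟩
    · rintro ⟨j, hj⟩
      rw [← hj]
      ext
      simp [f, g, hm, mul_comm]
  rw [injective_iff_map_eq_zero]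
  intro t ht
  have hgt : LinearMap.lTensor S g (LinearMap.lTensor S (LinearMap.inl R I R) t) = 0 := by
    apply hKinj
    rw [map_zero, ← ht, ← LinearMap.comp_apply, ← LinearMap.comp_apply, ← LinearMap.lTensor_comp,
      ← LinearMap.lTensor_comp]
    congr 2
    ext
    simp [g]
  obtain ⟨u, hu⟩ := (lTensor_exact S hfg hg _).mp hgt
  have hu0 : u = 0 := by
    apply hJinj
    have := congr(LinearMap.lTensor S (-LinearMap.snd R I R) $hu)
    simp only [← LinearMap.comp_apply, ← LinearMap.lTensor_comp] at this
    rw [map_zero]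
    convert! this using 2
    · congr 1
      ext
      simp [f]
    · simp
  have := congr(LinearMap.lTensor S (LinearMap.fst R I R) $hu)
  rw [hu0, map_zero, map_zero, ← LinearMap.comp_apply, ← LinearMap.lTensor_comp] at this
  simpa using this.symm

/-- A form of the local criterion of flatness: if `x` lies in the Jacobson radical of `S` and is
regular on `S`, and `S / xS` is flat over `R / xR`, then `S` is flat over `R`. -/
theorem Module.Flat.of_quotient_span_singleton [IsNoetherianRing R] [IsNoetherianRing S]
    (x : R) [Module.Flat (R ⧸ Ideal.span {x}) (S ⧸ (Ideal.span {x}).map (algebraMap R S))]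
    (hreg : IsSMulRegular S x) (hjac : algebraMap R S x ∈ Ring.jacobson S) :
    Module.Flat R S := by
  rw [Module.Flat.iff_lTensor_injective']
  intro I
  induction I using IsNoetherian.induction with
  | hgt I ih =>
    by_cases hxI : x ∈ I
    · exact lTensor_injective_of_mem x hreg I hxI
    by_cases hcol : ∀ r, x * r ∈ I → r ∈ I
    · exact lTensor_injective_of_regular_quotient x hreg hjac I hcol
    push Not at hcol
    obtain ⟨r, hr, hrI⟩ := hcol
    have hJ (r) : r ∈ Submodule.comap (LinearMap.lsmul R R x) I ↔ x * r ∈ I := by simp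
    refine lTensor_injective_of_colon x I _ _ hJ rfl (ih _ ?_) (ih _ ?_)
    · exact SetLike.lt_iff_le_and_exists.mpr
        ⟨fun a ha ↦ (hJ a).mpr (Ideal.mul_mem_left I x ha), r, (hJ r).mpr hr, hrI⟩
    · exact SetLike.lt_iff_le_and_exists.mpr
        ⟨le_sup_left, x, Ideal.mem_sup_right (Ideal.mem_span_singleton_self x), hxI⟩

end FlatnessModuloElement

/-! ### Regular local rings -/

section RegularLocalRing

open IsLocalRing RingTheory.Sequence

lemma ringKrullDim_eq_natCast (R : Type*) [CommRing R] [IsNoetherianRing R] [IsLocalRing R] :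
    ∃ n : ℕ, ringKrullDim R = n := by
  obtain ⟨m, hm⟩ := WithBot.ne_bot_iff_exists.mp (ringKrullDim_ne_bot (R := R))
  have hm' : m ≠ ⊤ := by
    rintro rfl
    exact ringKrullDim_ne_top hm.symm
  obtain ⟨n, rfl⟩ := ENat.ne_top_iff_exists.mp hm'
  exact ⟨n, hm.symm⟩

lemma isLocalRing_quotient_of_le_maximalIdeal {S : Type*} [CommRing S] [IsLocalRing S]
    {I : Ideal S} (hI : I ≤ maximalIdeal S) : IsLocalRing (S ⧸ I) := by
  have : Nontrivial (S ⧸ I) :=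
    Ideal.Quotient.nontrivial_iff.mpr (hI.trans_lt (maximalIdeal.isMaximal S).lt_top).ne
  exact .of_surjective' (Ideal.Quotient.mk _) Ideal.Quotient.mk_surjective

lemma ringKrullDim_le_quotient_span_singleton_add_one {R : Type*} [CommRing R]
    [IsNoetherianRing R] [IsLocalRing R] {x : R} (hx : x ∈ maximalIdeal R) :
    ringKrullDim R ≤ ringKrullDim (R ⧸ Ideal.span {x}) + 1 := by
  rw [← maximalIdeal_height_eq_ringKrullDim]
  exact Ideal.height_le_ringKrullDim_quotient_add_one hx

/-- An element of `𝔪 ∖ 𝔪²` is part of a minimal system of generators of `𝔪`. -/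
lemma exists_generators_of_notMem_sq {R : Type*} [CommRing R] [IsNoetherianRing R] [IsLocalRing R]
    {x : R} (hx : x ∈ maximalIdeal R) (hx2 : x ∉ maximalIdeal R ^ 2) :
    ∃ (n : ℕ) (y : Fin n → R), n + 1 = (maximalIdeal R).spanFinrank ∧
      Ideal.span (insert x (Set.range y)) = maximalIdeal R := by
  let v : CotangentSpace R := (maximalIdeal R).toCotangent ⟨x, hx⟩
  have hv : v ≠ 0 := fun h ↦ hx2 ((maximalIdeal R).toCotangent_eq_zero _ |>.mp h)
  let V := Submodule.span (ResidueField R) {v}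
  let b := Module.finBasis (ResidueField R) (CotangentSpace R ⧸ V)
  choose u hu using fun i ↦ Submodule.mkQ_surjective V (b i)
  choose y hy using fun i ↦ (maximalIdeal R).toCotangent_surjective (u i)
  refine ⟨_, fun i ↦ y i, ?_, ?_⟩
  · rw [spanFinrank_maximalIdeal_eq_finrank_cotangentSpace, ← V.finrank_quotient_add_finrank,
      finrank_span_singleton hv]
  · have h1 : Submodule.span (ResidueField R)
        ((maximalIdeal R).toCotangent '' insert ⟨x, hx⟩ (Set.range y)) = ⊤ := by
      have h2 : (V ⊔ Submodule.span (ResidueField R) (Set.range u)) = ⊤ := by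
        rw [← Submodule.map_mkQ_eq_top, Submodule.map_span, ← Set.range_comp,
          ← b.span_eq]
        exact congr(Submodule.span _ (Set.range $(funext hu)))
      rw [← h2, Set.image_insert_eq, Submodule.span_insert, ← Set.range_comp]
      exact congr(_ ⊔ Submodule.span _ (Set.range $(funext hy)))
    rw [CotangentSpace.span_image_eq_top_iff] at h1
    have h3 := congr(Submodule.map (maximalIdeal R).subtype $h1)
    rwa [Submodule.map_span, Submodule.map_top, Submodule.range_subtype, Set.image_insert_eq,
      ← Set.range_comp] at h3

/-- The quotient of a regular local ring by an element of `𝔪 ∖ 𝔪²` is regular, of dimension one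
less. -/
lemma IsRegularLocalRing.quotient_span_singleton {R : Type*} [CommRing R] [IsRegularLocalRing R]
    {x : R} (hx : x ∈ maximalIdeal R) (hx2 : x ∉ maximalIdeal R ^ 2) :
    IsRegularLocalRing (R ⧸ Ideal.span {x}) ∧
      ringKrullDim (R ⧸ Ideal.span {x}) + 1 = ringKrullDim R := by
  have := isLocalRing_quotient_of_le_maximalIdeal ((Ideal.span_singleton_le_iff_mem _).mpr hx)
  obtain ⟨n, y, hn, hy⟩ := exists_generators_of_notMem_sq hx hx2
  have hle : (maximalIdeal (R ⧸ Ideal.span {x})).spanFinrank ≤ n := by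
    have h : maximalIdeal (R ⧸ Ideal.span {x}) =
        Ideal.span (Set.range fun i ↦ Ideal.Quotient.mk (Ideal.span {x}) (y i)) := by
      rw [← map_maximalIdeal_of_surjective _ (Ideal.Quotient.mk_surjective (I := Ideal.span {x})),
        ← hy, Ideal.map_span, Set.image_insert_eq, ← Set.range_comp,
        (Ideal.Quotient.eq_zero_iff_mem).mpr (Ideal.mem_span_singleton_self x),
        Ideal.span_insert_zero]
      rfl
    rw [h]
    refine (Submodule.spanFinrank_span_le_ncard_of_finite (Set.finite_range _)).trans ?_
    rw [← Set.image_univ]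
    exact (Set.ncard_image_le Set.finite_univ).trans (by simp)
  have hdim := (isRegularLocalRing_iff R).mp inferInstance
  have hdim' := ringKrullDim_le_quotient_span_singleton_add_one hx
  have hdim'' := ringKrullDim_le_spanFinrank_maximalIdeal (R ⧸ Ideal.span {x})
  obtain ⟨d, hd⟩ := ringKrullDim_eq_natCast R
  obtain ⟨e, he⟩ := ringKrullDim_eq_natCast (R ⧸ Ideal.span {x})
  rw [hd, ← hn] at hdim
  rw [he] at hdim' hdim''
  rw [hd] at hdim'
  norm_cast at hdim hdim' hdim''
  constructor
  · apply IsRegularLocalRing.of_spanFinrank_maximalIdeal_le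
    rw [he]
    norm_cast
    lia
  · rw [he, hd]
    norm_cast
    lia

lemma not_maximalIdeal_le_sq {R : Type*} [CommRing R] [IsNoetherianRing R] [IsLocalRing R]
    (h : ringKrullDim R ≠ 0) : ¬ maximalIdeal R ≤ maximalIdeal R ^ 2 := by
  intro hle
  apply h
  apply ringKrullDim_eq_zero_of_isField
  rw [isField_iff_maximalIdeal_eq]
  refine Submodule.eq_bot_of_le_smul_of_le_jacobson_bot _ _ (IsNoetherian.noetherian _)
    (hle.trans_eq ?_) (IsLocalRing.jacobson_eq_maximalIdeal _ bot_ne_top).ge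
  rw [smul_eq_mul, pow_two]

lemma IsRegularLocalRing.isField_of_ringKrullDim_eq_zero {R : Type*} [CommRing R]
    [IsRegularLocalRing R] (h : ringKrullDim R = 0) : IsField R := by
  rw [isField_iff_maximalIdeal_eq, ← Submodule.spanFinrank_eq_zero_iff_eq_bot
    (IsNoetherian.noetherian _), ← Nat.cast_inj (R := WithBot ℕ∞),
    (isRegularLocalRing_iff R).mp inferInstance, h, Nat.cast_zero]

/-- A regular local ring is a domain. By prime avoidance some `x` in `𝔪 ∖ 𝔪²` lies in no minimal
prime, and by induction on the dimension `x` generates a prime ideal. A minimal prime `q` contained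
in `(x)` satisfies `q = x q`, hence vanishes by Nakayama's lemma. -/
theorem IsRegularLocalRing.isDomain (R : Type*) [CommRing R] [IsRegularLocalRing R] :
    IsDomain R := by
  obtain ⟨n, hn⟩ := ringKrullDim_eq_natCast R
  induction n generalizing R with
  | zero => exact (isField_of_ringKrullDim_eq_zero (by simpa using hn)).isDomain
  | succ n ih =>
    have hdim : ringKrullDim R ≠ 0 := by
      rw [hn]
      norm_cast
    obtain ⟨x, hx, hx2, hxmin⟩ : ∃ x ∈ maximalIdeal R, x ∉ maximalIdeal R ^ 2 ∧
        ∀ q ∈ minimalPrimes R, x ∉ q := by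
      by_contra! hcon
      have hsub : (maximalIdeal R : Set R) ⊆
          ⋃ q ∈ insert (maximalIdeal R ^ 2) (minimalPrimes R), (id q : Ideal R) := by
        intro x hx
        simp only [Set.mem_iUnion]
        by_cases h2 : x ∈ maximalIdeal R ^ 2
        · exact ⟨_, Set.mem_insert _ _, h2⟩
        · obtain ⟨q, hq, hxq⟩ := hcon x hx h2
          exact ⟨q, Set.mem_insert_of_mem _ hq, hxq⟩
      obtain ⟨q, rfl | hq, hle⟩ := (Ideal.subset_union_prime_finite
        ((minimalPrimes.finite_of_isNoetherianRing R).insert _) (f := id) (maximalIdeal R ^ 2)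
        (maximalIdeal R ^ 2)
        (fun q hq h _ ↦ (Set.mem_of_mem_insert_of_ne hq h).isPrime)).mp hsub
      · exact not_maximalIdeal_le_sq hdim hle
      · have hqp := hq.isPrime
        have : maximalIdeal R = q := le_antisymm hle (le_maximalIdeal hqp.ne_top)
        rw [← this, ← Ideal.height_eq_zero_iff] at hq
        rw [← maximalIdeal_height_eq_ringKrullDim, hq] at hdim
        exact hdim rfl
    obtain ⟨hreg, hd⟩ := IsRegularLocalRing.quotient_span_singleton hx hx2
    have hdom := ih (R ⧸ Ideal.span {x}) (by
      obtain ⟨e, he⟩ := ringKrullDim_eq_natCast (R ⧸ Ideal.span {x})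
      rw [he, hn] at hd
      rw [he]
      norm_cast at hd ⊢
      lia)
    have hprime := (Ideal.Quotient.isDomain_iff_prime _).mp hdom
    obtain ⟨q, hq, hqx⟩ := Ideal.exists_minimalPrimes_le (bot_le (a := Ideal.span {x}))
    have hqp := hq.isPrime
    have hbot : q = ⊥ := by
      refine Submodule.eq_bot_of_le_smul_of_le_jacobson_bot (Ideal.span {x}) _
        (IsNoetherian.noetherian _) ?_ ?_
      · intro y hy
        obtain ⟨a, rfl⟩ := Ideal.mem_span_singleton.mp (hqx hy)
        exact Ideal.mul_mem_mul (Ideal.mem_span_singleton_self x)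
          ((hqp.mem_or_mem hy).resolve_left (hxmin q hq))
      · rw [IsLocalRing.jacobson_eq_maximalIdeal _ bot_ne_top]
        simpa [Ideal.span_singleton_le_iff_mem] using hx
    rw [hbot] at hqp
    exact IsDomain.of_bot_isPrime R

/-- Regular sequences of the module `R / xR` over `R` are the same as those of the ring `R / xR`. -/
lemma exists_isWeaklyRegular_quotient_iff {R : Type*} [CommRing R] [IsLocalRing R] {x : R}
    [IsLocalRing (R ⧸ Ideal.span {x})] (n : ℕ) :
    (∃ rs : List (R ⧸ Ideal.span {x}), rs.length = n ∧
      (∀ r ∈ rs, r ∈ maximalIdeal (R ⧸ Ideal.span {x})) ∧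
      IsWeaklyRegular (R ⧸ Ideal.span {x}) rs) ↔
    ∃ rs : List R, rs.length = n ∧ (∀ r ∈ rs, r ∈ maximalIdeal R) ∧
      IsWeaklyRegular (QuotSMulTop x R) rs := by
  let e : QuotSMulTop x R ≃ₗ[R] R ⧸ Ideal.span {x} := Submodule.quotEquivOfEq _ _ (by
    simp [← Submodule.ideal_span_singleton_smul])
  have hloc : IsLocalHom (algebraMap R (R ⧸ Ideal.span {x})) :=
    .of_surjective _ Ideal.Quotient.mk_surjective
  have hmem (r : R) : algebraMap R (R ⧸ Ideal.span {x}) r ∈ maximalIdeal (R ⧸ Ideal.span {x}) ↔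
      r ∈ maximalIdeal R := by
    simp
  constructor
  · rintro ⟨rs, hlen, hrs, hreg⟩
    obtain ⟨rs, rfl⟩ := (List.map_surjective_iff.mpr
      (Ideal.Quotient.mk_surjective (I := Ideal.span {x}))) rs
    refine ⟨rs, by simpa using hlen, fun r hr ↦ (hmem r).mp (hrs _ (List.mem_map_of_mem hr)), ?_⟩
    rw [e.isWeaklyRegular_congr]
    exact (isWeaklyRegular_map_algebraMap_iff _ _ rs).mp hreg
  · rintro ⟨rs, hlen, hrs, hreg⟩
    refine ⟨rs.map (algebraMap R _), by simpa using hlen, ?_, ?_⟩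
    · intro r hr
      obtain ⟨r', hr', rfl⟩ := List.mem_map.mp hr
      exact (hmem r').mpr (hrs r' hr')
    · rw [isWeaklyRegular_map_algebraMap_iff]
      exact (e.isWeaklyRegular_congr rs).mp hreg

/-- Regular local rings are Cohen–Macaulay: there is a regular sequence of length the dimension. -/
theorem IsRegularLocalRing.exists_isWeaklyRegular (R : Type*) [CommRing R] [IsRegularLocalRing R] :
    ∃ rs : List R, (rs.length : WithBot ℕ∞) = ringKrullDim R ∧
      (∀ r ∈ rs, r ∈ maximalIdeal R) ∧ IsWeaklyRegular R rs := by
  obtain ⟨n, hn⟩ := ringKrullDim_eq_natCast R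
  simp_rw [hn, Nat.cast_inj]
  induction n generalizing R with
  | zero => exact ⟨[], by simp⟩
  | succ n ih =>
    have hdim : ringKrullDim R ≠ 0 := by
      rw [hn]
      norm_cast
    obtain ⟨x, hx, hx2⟩ := SetLike.not_le_iff_exists.mp (not_maximalIdeal_le_sq hdim)
    obtain ⟨hreg, hd⟩ := IsRegularLocalRing.quotient_span_singleton hx hx2
    have hdom := IsRegularLocalRing.isDomain R
    have hx0 : x ≠ 0 := fun h ↦ hx2 (h ▸ zero_mem _)
    have := ih (R ⧸ Ideal.span {x}) (by
      obtain ⟨e, he⟩ := ringKrullDim_eq_natCast (R ⧸ Ideal.span {x})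
      rw [he, hn] at hd
      rw [he]
      norm_cast at hd ⊢
      lia)
    obtain ⟨rs, hlen, hrs, hrsreg⟩ := (exists_isWeaklyRegular_quotient_iff n).mp this
    exact ⟨x :: rs, by simpa using hlen, by simpa using ⟨hx, hrs⟩,
      (isWeaklyRegular_cons_iff R x rs).mpr
        ⟨fun a b h ↦ mul_left_cancel₀ hx0 h, hrsreg⟩⟩

end RegularLocalRing

/-! ### Depth and associated primes -/

section Depth

open IsLocalRing RingTheory.Sequence Abelian Pointwise

universe u

/-- If `y` is regular on `M`, every associated prime `p` of `M` lies in an associated prime of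
`M / yM` containing `y`. Indeed the submodule of elements killed by `p` is not contained in `yM`:
otherwise it would equal its multiple by `y`, contradicting Nakayama's lemma. -/
lemma exists_mem_associatedPrimes_quotSMulTop {S M : Type*} [CommRing S] [IsNoetherianRing S]
    [IsLocalRing S] [AddCommGroup M] [Module S M] [Module.Finite S M] {y : S}
    (hy : y ∈ maximalIdeal S) (hreg : IsSMulRegular M y) {p : Ideal S}
    (hp : p ∈ associatedPrimes S M) :
    ∃ q ∈ associatedPrimes S (QuotSMulTop y M), p ≤ q ∧ y ∈ q := by
  obtain ⟨hprime, m, hm⟩ := isAssociatedPrime_iff.mp hp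
  let N : Submodule S M :=
    { carrier := {m | ∀ r ∈ p, r • m = 0}
      add_mem' := fun ha hb r hr ↦ by rw [smul_add, ha r hr, hb r hr, add_zero]
      zero_mem' := fun r _ ↦ smul_zero r
      smul_mem' := fun c a ha r hr ↦ by rw [smul_comm, ha r hr, smul_zero] }
  have hmN : m ∈ N := fun r hr ↦ by simpa [hm, Submodule.mem_colon_singleton] using hr
  have hN : N ≠ ⊥ := by
    rintro h
    rw [h, Submodule.mem_bot] at hmN
    apply hprime.ne_top
    rw [hm, hmN]
    simp
  obtain ⟨a, ha, hay⟩ : ∃ a ∈ N, a ∉ y • (⊤ : Submodule S M) := by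
    by_contra! hcon
    apply hN
    refine Submodule.eq_bot_of_le_smul_of_le_jacobson_bot (Ideal.span {y}) _
      (IsNoetherian.noetherian _) ?_ ?_
    · intro a ha
      obtain ⟨b, -, rfl⟩ := (Submodule.mem_smul_pointwise_iff_exists _ _ _).mp (hcon a ha)
      refine Submodule.smul_mem_smul (Ideal.mem_span_singleton_self y) fun r hr ↦ ?_
      refine hreg.right_eq_zero_of_smul ?_
      rw [smul_comm]
      exact ha r hr
    · rw [IsLocalRing.jacobson_eq_maximalIdeal _ bot_ne_top]
      simpa [Ideal.span_singleton_le_iff_mem] using hy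
  have ha0 : (Submodule.Quotient.mk a : QuotSMulTop y M) ≠ 0 := by
    rwa [Ne, Submodule.Quotient.mk_eq_zero]
  obtain ⟨q, hq, hle⟩ := exists_le_isAssociatedPrime_of_isNoetherianRing S _ ha0
  refine ⟨q, hq, fun r hr ↦ hle ?_, hle ?_⟩
  · rw [Submodule.mem_colon_singleton, ← Submodule.Quotient.mk_smul, ha r hr]
    simp
  · rw [Submodule.mem_colon_singleton, ← Submodule.Quotient.mk_smul, Submodule.mem_bot,
      Submodule.Quotient.mk_eq_zero]
    exact Submodule.smul_mem_pointwise_smul _ _ _ trivial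

/-- The length of a regular sequence on `M` is at most the dimension of `S / p` for any associated
prime `p` of `M`. -/
theorem length_le_ringKrullDim_quotient_of_mem_associatedPrimes {S : Type*} [CommRing S]
    [IsNoetherianRing S] [IsLocalRing S] (rs : List S) {M : Type*} [AddCommGroup M] [Module S M]
    [Module.Finite S M] (hrs : ∀ r ∈ rs, r ∈ maximalIdeal S) (hreg : IsWeaklyRegular M rs)
    {p : Ideal S} (hp : p ∈ associatedPrimes S M) :
    (rs.length : WithBot ℕ∞) ≤ ringKrullDim (S ⧸ p) := by
  have hprime := hp.isPrime
  induction rs generalizing M p with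
  | nil => simpa using ringKrullDim_nonneg_of_nontrivial
  | cons y rs ih =>
    obtain ⟨hy, hreg⟩ := (isWeaklyRegular_cons_iff M y rs).mp hreg
    obtain ⟨q, hq, hpq, hyq⟩ :=
      exists_mem_associatedPrimes_quotSMulTop (hrs y (by simp)) hy hp
    have hle := ih (fun r hr ↦ hrs r (by simp [hr])) hreg hq hq.isPrime
    have hyp : y ∉ p := by
      intro hyp
      have : y ∈ ⋃ p ∈ associatedPrimes S M, (p : Set S) := Set.mem_biUnion hp hyp
      rw [biUnion_associatedPrimes_eq_compl_regular] at this
      exact this hy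
    have hnz : Ideal.Quotient.mk p y ∈ nonZeroDivisors (S ⧸ p) := by
      rwa [mem_nonZeroDivisors_iff_ne_zero, Ne, Ideal.Quotient.eq_zero_iff_mem]
    have hsurj : ringKrullDim (S ⧸ q) + 1 ≤ ringKrullDim (S ⧸ p) := by
      refine ringKrullDim_succ_le_of_surjective (Ideal.Quotient.factor hpq)
        (Ideal.Quotient.factor_surjective hpq) hnz ?_
      simpa [Ideal.Quotient.eq_zero_iff_mem] using hyq
    refine le_trans ?_ hsurj
    rw [List.length_cons, Nat.cast_add, Nat.cast_one]
    gcongr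

/-- In a Cohen–Macaulay local ring, an element which cuts down the dimension is regular. -/
theorem isSMulRegular_of_ringKrullDim_quotient_lt {S : Type*} [CommRing S]
    [IsNoetherianRing S] [IsLocalRing S] {rs : List S} (hrs : ∀ r ∈ rs, r ∈ maximalIdeal S)
    (hreg : IsWeaklyRegular S rs) {y : S}
    (hy : ringKrullDim (S ⧸ Ideal.span {y}) < rs.length) : IsSMulRegular S y := by
  by_contra hcon
  have : y ∈ ⋃ p ∈ associatedPrimes S S, (p : Set S) := by
    rw [biUnion_associatedPrimes_eq_compl_regular]
    exact hcon
  simp only [Set.mem_iUnion] at this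
  obtain ⟨p, hp, hyp⟩ := this
  refine ((length_le_ringKrullDim_quotient_of_mem_associatedPrimes rs hrs hreg hp).trans ?_).not_gt
    hy
  have hle : Ideal.span {y} ≤ p := (Ideal.span_singleton_le_iff_mem _).mpr hyp
  exact ringKrullDim_le_of_surjective (Ideal.Quotient.factor hle)
    (Ideal.Quotient.factor_surjective hle)

/-- If the local ring `S` has a regular sequence of length `n + 1`, then for every regular `y` in
the maximal ideal, `S / yS` has one of length `n`. This follows from Rees' characterization of
depth through the vanishing of `Ext`. -/
theorem exists_isWeaklyRegular_quotSMulTop {S : Type u} [CommRing S] [IsNoetherianRing S]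
    [IsLocalRing S] {rs : List S} (hrs : ∀ r ∈ rs, r ∈ maximalIdeal S)
    (hreg : IsWeaklyRegular S rs) {n : ℕ} (hn : rs.length = n + 1) {y : S}
    (hy : y ∈ maximalIdeal S) (hyreg : IsSMulRegular S y) :
    ∃ rs : List S, rs.length = n ∧ (∀ r ∈ rs, r ∈ maximalIdeal S) ∧
      IsWeaklyRegular (QuotSMulTop y S) rs := by
  have hnt : Nontrivial (QuotSMulTop y S) := nontrivial_quotSMulTop_of_mem_maximalIdeal S hy
  have hlt (M : Type u) [AddCommGroup M] [Module S M] [Module.Finite S M] [Nontrivial M] :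
      maximalIdeal S • (⊤ : Submodule S M) < ⊤ :=
    (Submodule.top_ne_ideal_smul_of_le_jacobson_annihilator
      (maximalIdeal_le_jacobson _)).symm.lt_top
  have hrees := (ModuleCat.exists_isRegular_tfae (maximalIdeal S) (n + 1) (ModuleCat.of S S)
    (hlt S)).out 3 1
  have hext := hrees.mp
    ⟨rs, hn, hrs, IsRegular.of_isWeaklyRegular_of_mem_maximalIdeal S hrs hreg⟩
  have hrees' := (ModuleCat.exists_isRegular_tfae (maximalIdeal S) n
    (ModuleCat.of S (QuotSMulTop y S)) (hlt (QuotSMulTop y S))).out 1 3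
  obtain ⟨rs', hlen, hrs', hreg'⟩ := hrees'.mp fun i hi ↦ by
      have zero1 := AddCommGrpCat.isZero_of_iff_subsingleton.mpr (hext i (by lia))
      have zero2 := AddCommGrpCat.isZero_of_iff_subsingleton.mpr (hext (i + 1) (by lia))
      exact AddCommGrpCat.subsingleton_of_isZero <| ShortComplex.Exact.isZero_of_both_zeros
        ((Ext.covariant_sequence_exact₃' _
          (IsSMulRegular.smulShortComplex_shortExact (M := ModuleCat.of S S) hyreg)) i (i + 1) rfl)
        (zero1.eq_zero_of_src _) (zero2.eq_zero_of_tgt _)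
  exact ⟨rs', hlen, hrs', hreg'.toIsWeaklyRegular⟩

end Depth

/-! ### Flatness over a regular local ring -/

section MiracleFlatness

open IsLocalRing RingTheory.Sequence

/-- The dimension of a local algebra is at most the dimension of the base plus the dimension of
the closed fibre. -/
lemma ringKrullDim_le_add_ringKrullDim_quotient_map {R S : Type*} [CommRing R] [CommRing S]
    [IsNoetherianRing R] [IsNoetherianRing S] [IsLocalRing R] [IsLocalRing S] [Algebra R S]
    [IsLocalHom (algebraMap R S)] :
    ringKrullDim S ≤
      ringKrullDim R + ringKrullDim (S ⧸ (maximalIdeal R).map (algebraMap R S)) := by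
  have hle := map_maximalIdeal_le (algebraMap R S)
  have := isLocalRing_quotient_of_le_maximalIdeal hle
  have : (maximalIdeal S).LiesOver (maximalIdeal R) := ⟨(maximalIdeal_comap (algebraMap R S)).symm⟩
  have h := Ideal.height_le_height_add_of_liesOver (maximalIdeal R) (maximalIdeal S)
  rw [map_maximalIdeal_of_surjective _ Ideal.Quotient.mk_surjective] at h
  simp_rw [← maximalIdeal_height_eq_ringKrullDim]
  exact_mod_cast h

universe u

/-- Miracle flatness: a local homomorphism from a regular local ring to a Cohen–Macaulay local
ring `S` is flat if `dim S` is at least the dimension of the base plus that of the closed fibre. -/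
theorem Module.Flat.of_isRegularLocalRing_of_ringKrullDim_le {R : Type*} {S : Type u} [CommRing R]
    [CommRing S] [IsRegularLocalRing R] [IsNoetherianRing S] [IsLocalRing S] [Algebra R S]
    [IsLocalHom (algebraMap R S)]
    (hCM : ∃ rs : List S, (rs.length : WithBot ℕ∞) = ringKrullDim S ∧
      (∀ r ∈ rs, r ∈ maximalIdeal S) ∧ IsWeaklyRegular S rs)
    (hdim : ringKrullDim R + ringKrullDim (S ⧸ (maximalIdeal R).map (algebraMap R S)) ≤
      ringKrullDim S) :
    Module.Flat R S := by
  obtain ⟨n, hn⟩ := ringKrullDim_eq_natCast R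
  induction n generalizing R S with
  | zero =>
    let := (IsRegularLocalRing.isField_of_ringKrullDim_eq_zero (by simpa using hn)).toField
    infer_instance
  | succ n ih =>
    have hR : ringKrullDim R ≠ 0 := by
      rw [hn]
      norm_cast
    obtain ⟨x, hx, hx2⟩ := SetLike.not_le_iff_exists.mp (not_maximalIdeal_le_sq hR)
    obtain ⟨hreg, hd⟩ := IsRegularLocalRing.quotient_span_singleton hx hx2
    have hy : algebraMap R S x ∈ maximalIdeal S := by simpa using hx
    have hmap : (Ideal.span {x}).map (algebraMap R S) = Ideal.span {algebraMap R S x} := by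
      rw [Ideal.map_span, Set.image_singleton]
    let R' := R ⧸ Ideal.span {x}
    let S' := S ⧸ (Ideal.span {x}).map (algebraMap R S)
    have hS' : IsLocalRing S' := isLocalRing_quotient_of_le_maximalIdeal (by
      rw [hmap]
      exact (Ideal.span_singleton_le_iff_mem _).mpr hy)
    have hloc : IsLocalHom (algebraMap R' S') := by
      have h1 : IsLocalHom ((algebraMap R' S').comp (Ideal.Quotient.mk _)) := by
        have h2 : IsLocalHom (Ideal.Quotient.mk ((Ideal.span {x}).map (algebraMap R S))) :=
          .of_surjective _ Ideal.Quotient.mk_surjective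
        exact RingHom.isLocalHom_comp (Ideal.Quotient.mk _) (algebraMap R S)
      exact ⟨fun a ha ↦ by
        obtain ⟨r, rfl⟩ := Ideal.Quotient.mk_surjective a
        exact (h1.map_nonunit r ha).map _⟩
    -- The closed fibre of `R' → S'` is a quotient of the closed fibre of `R → S`.
    have hfib : ringKrullDim (S' ⧸ (maximalIdeal R').map (algebraMap R' S')) ≤
        ringKrullDim (S ⧸ (maximalIdeal R).map (algebraMap R S)) := by
      let g : S →+* S' ⧸ (maximalIdeal R').map (algebraMap R' S') :=
        (Ideal.Quotient.mk _).comp (Ideal.Quotient.mk _)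
      have hg : Function.Surjective g :=
        Ideal.Quotient.mk_surjective.comp Ideal.Quotient.mk_surjective
      have hker : ∀ a ∈ (maximalIdeal R).map (algebraMap R S), g a = 0 := by
        change _ ≤ RingHom.ker g
        rw [Ideal.map_le_iff_le_comap]
        intro r hr
        change Ideal.Quotient.mk _ (algebraMap R' S' (Ideal.Quotient.mk _ r)) = 0
        rw [Ideal.Quotient.eq_zero_iff_mem]
        refine Ideal.mem_map_of_mem _ ?_
        rw [← map_maximalIdeal_of_surjective _
          (Ideal.Quotient.mk_surjective (I := Ideal.span {x}))]
        exact Ideal.mem_map_of_mem _ hr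
      exact ringKrullDim_le_of_surjective (Ideal.Quotient.lift _ g hker)
        (Ideal.Quotient.lift_surjective_of_surjective _ _ hg)
    -- Comparing dimensions gives `dim S' + 1 = dim S`, so the image of `x` in `S` is regular.
    have hle : ringKrullDim S' ≤ ringKrullDim R' + _ :=
      ringKrullDim_le_add_ringKrullDim_quotient_map
    have hle' : ringKrullDim S ≤ ringKrullDim S' + 1 := by
      change _ ≤ ringKrullDim (S ⧸ _) + 1
      rw [hmap]
      exact ringKrullDim_le_quotient_span_singleton_add_one hy
    have := isLocalRing_quotient_of_le_maximalIdeal (map_maximalIdeal_le (algebraMap R S))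
    have := isLocalRing_quotient_of_le_maximalIdeal (map_maximalIdeal_le (algebraMap R' S'))
    obtain ⟨a, ha⟩ := ringKrullDim_eq_natCast R'
    obtain ⟨s, hs⟩ := ringKrullDim_eq_natCast S
    obtain ⟨b, hb⟩ := ringKrullDim_eq_natCast S'
    obtain ⟨c, hc⟩ := ringKrullDim_eq_natCast (S ⧸ (maximalIdeal R).map (algebraMap R S))
    obtain ⟨d, hd'⟩ := ringKrullDim_eq_natCast (S' ⧸ (maximalIdeal R').map (algebraMap R' S'))
    obtain ⟨rs, hlen, hrs, hrsreg⟩ := hCM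
    rw [ha, hn] at hd
    rw [hn, hs, hc] at hdim
    rw [hd', hc] at hfib
    rw [hb, ha, hd'] at hle
    rw [hs, hb] at hle'
    rw [hs] at hlen
    norm_cast at hd hdim hfib hle hle' hlen
    have hyreg : IsSMulRegular S (algebraMap R S x) := by
      refine isSMulRegular_of_ringKrullDim_quotient_lt hrs hrsreg ?_
      rw [← hmap]
      change ringKrullDim S' < _
      rw [hb]
      norm_cast
      lia
    have hflat : Module.Flat R' S' := by
      refine ih ?_ ?_ ?_
      · rw [hb]
        simp_rw [Nat.cast_inj]
        have hquot := exists_isWeaklyRegular_quotSMulTop hrs hrsreg (n := b) (by lia) hy hyreg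
        have hcongr : ∀ (I : Ideal S) [IsLocalRing (S ⧸ I)], I = Ideal.span {algebraMap R S x} →
            ∃ rs : List (S ⧸ I), rs.length = b ∧ (∀ r ∈ rs, r ∈ maximalIdeal (S ⧸ I)) ∧
              IsWeaklyRegular (S ⧸ I) rs := by
          rintro _ _ rfl
          exact (exists_isWeaklyRegular_quotient_iff b).mpr hquot
        exact hcongr _ hmap
      · rw [ha, hd', hb]
        norm_cast
        lia
      · rw [ha]
        norm_cast
        lia
    refine Module.Flat.of_quotient_span_singleton x ?_ ?_
    · exact fun a b h ↦ hyreg (by simpa [Algebra.smul_def] using h)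
    · rwa [IsLocalRing.ringJacobson_eq_maximalIdeal]

end MiracleFlatness

/-! ### The local ring of a fibre -/

section Fibre

open IsLocalRing Limits

/-- The local ring of the fibre through `x` surjects onto the quotient of `𝒪_{X,x}` by the extension
of the maximal ideal of `𝒪_{Y,f(x)}`. Indeed the spectrum of this quotient maps to the fibre, and
this map is a preimmersion because its composition with `Spec 𝒪_{X,x} ⟶ X` is one. -/
lemma ringKrullDim_quotient_map_le_dimAt_fiber {X Y : Scheme.{0}} (f : X ⟶ Y) (x : X) :
    ringKrullDim (X.presheaf.stalk x ⧸
      (maximalIdeal (Y.presheaf.stalk (f x))).map (f.stalkMap x).hom) ≤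
      dimAt (f.fiber (f x)) (f.asFiber x) := by
  let I := (maximalIdeal (Y.presheaf.stalk (f x))).map (f.stalkMap x).hom
  have hloc : IsLocalRing (X.presheaf.stalk x ⧸ I) :=
    isLocalRing_quotient_of_le_maximalIdeal (map_maximalIdeal_le _)
  let A : CommRingCat := .of (X.presheaf.stalk x ⧸ I)
  have hA : IsLocalRing A := hloc
  let π : X.presheaf.stalk x ⟶ A := CommRingCat.ofHom (Ideal.Quotient.mk I)
  have hπ : Function.Surjective π := Ideal.Quotient.mk_surjective
  have hπloc : IsLocalHom π.hom := .of_surjective _ hπ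
  let ρ : Y.residueField (f x) ⟶ A := CommRingCat.ofHom
    (Ideal.Quotient.lift (maximalIdeal (Y.presheaf.stalk (f x))) (π.hom.comp (f.stalkMap x).hom)
      fun a ha ↦ Ideal.Quotient.eq_zero_iff_mem.mpr (Ideal.mem_map_of_mem _ ha))
  have hρ : f.stalkMap x ≫ π = Y.residue (f x) ≫ ρ := rfl
  let g : Spec A ⟶ f.fiber (f x) :=
    pullback.lift (Spec.map π ≫ X.fromSpecStalk x) (Spec.map ρ) (by
      rw [Category.assoc, ← Scheme.SpecMap_stalkMap_fromSpecStalk, ← Spec.map_comp_assoc, hρ,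
        Spec.map_comp_assoc]
      rfl)
  have hgι : g ≫ f.fiberι (f x) = Spec.map π ≫ X.fromSpecStalk x := pullback.lift_fst _ _ _
  have hcl : IsClosedImmersion (Spec.map π) := IsClosedImmersion.spec_of_surjective _ hπ
  have hg : IsPreimmersion g := by
    have : IsPreimmersion (g ≫ f.fiberι (f x)) := by
      rw [hgι]
      infer_instance
    exact .of_comp g (f.fiberι (f x))
  have hpt : g (closedPoint A) = f.asFiber x := by
    apply (f.fiberι (f x)).isEmbedding.injective
    rw [Scheme.Hom.fiberι_asFiber]
    have h1 : Spec.map π (closedPoint A) = closedPoint (X.presheaf.stalk x) :=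
      comap_closedPoint π.hom
    calc f.fiberι (f x) (g (closedPoint A))
        = (g ≫ f.fiberι (f x)) (closedPoint A) := rfl
      _ = X.fromSpecStalk x (Spec.map π (closedPoint A)) := by rw [hgι]; rfl
      _ = x := by rw [h1, Scheme.fromSpecStalk_closedPoint]
  rw [← hpt]
  exact ringKrullDim_le_of_surjective (Scheme.stalkClosedPointTo g).hom
    ((stalkClosedPointIso A).commRingCatIsoToRingEquiv.surjective.comp
      (g.stalkMap_surjective (closedPoint A)))

end Fibre

/-! ### Flatness of morphisms of regular schemes -/

theorem mainTheorem8 {X Y : Scheme.{0}} [X.Over SpecC] [Y.Over SpecC]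
    (hX : IsQuasiProjectiveC X) (hY : IsQuasiProjectiveC Y)
    (hXreg : IsRegularScheme X) (hYreg : IsRegularScheme Y)
    (f : X ⟶ Y) [f.IsOver SpecC] (x : X)
    (hdim : dimAt X x = dimAt Y (f x) + dimAt (f.fiber (f x)) (f.asFiber x)) :
    IsFlatAt f x := by
  have := hXreg x
  have := hYreg (f x)
  algebraize [(f.stalkMap x).hom]
  have : IsLocalHom (algebraMap (Y.presheaf.stalk (f x)) (X.presheaf.stalk x)) :=
    inferInstanceAs (IsLocalHom (f.stalkMap x).hom)
  refine Module.Flat.of_isRegularLocalRing_of_ringKrullDim_le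
    (IsRegularLocalRing.exists_isWeaklyRegular _) ?_
  refine le_trans ?_ hdim.ge
  gcongr
  · exact le_rfl
  · exact ringKrullDim_quotient_map_le_dimAt_fiber f x
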